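/- Let $S$ be a set of $n$ points in $\mathbb{R}^2$, no three of which are collinear, and let $\kappa\colon S\to K$ be an assignment of colors from a set $K$ of $m$ colors in which every color is used. For an oriented segment $\sigma$ with two distinct endpoints $p,q\in S$, let $\sigma^+$ be the open half-plane on the positive (left) side of the line through $p$ and $q$ directed from $p$ to $q$; each pair of points thus determines two oriented segments, one for each side of its line. A color $i\in K$ is intersected by $\sigma^+$ if $\sigma^+$ contains a point $s\in S$ with $\kappa(s)=i$. For $c\in\{1,2\}$ and $j\ge 0$, the segment $\sigma$ is a $c$-chromatic (colored) $j$-facet if $|\{\kappa(p),\kappa(q)\}|=c$, exactly $j$ colors are intersected by $\sigma^+$, and neither $\kappa(p)$ nor $\kappa(q)$ is among them. Let $e_{c,j}(S)$ be the number of $c$-chromatic $j$-facets in $S$. Then for every integer $k$ with $0\le k\le m-2$, \[ (k+1)(k+2)\ \le\ \sum_{j=0}^{k} e_{2,j}(S)+\sum_{j=0}^{k}(k-j+1)\,e_{1,j}(S)\ \le\ (k+1)(2n-k-2). \] -/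

import Mathlib

namespace ColoredFacets

/-- The Euclidean plane. -/
abbrev Plane : Type := EuclideanSpace ℝ (Fin 2)

/-- No three distinct points of `S` lie on a common line. -/
def NoThreeCollinear (S : Finset Plane) : Prop :=
  ∀ p ∈ S, ∀ q ∈ S, ∀ r ∈ S, p ≠ q → p ≠ r → q ≠ r → ¬ Collinear ℝ ({p, q, r} : Set Plane)

/-- The open half-plane on the positive side of the segment oriented from `p` to `q`
(the points strictly to the left of the line directed from `p` to `q`). -/
def posSide (p q : Plane) : Set Plane :=
  {x | 0 < (q 0 - p 0) * (x 1 - p 1) - (q 1 - p 1) * (x 0 - p 0)}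

/-- The set of colors intersected by a subset `A` of the plane: those `i` such that `A` contains
a point of `S` of color `i`. -/
def colorsMet {S : Finset Plane} {m : ℕ} (κ : S → Fin m) (A : Set Plane) : Set (Fin m) :=
  {i | ∃ s : S, κ s = i ∧ (s : Plane) ∈ A}

/-- The set of `c`-chromatic colored `j`-facets of `S` with respect to `κ`. An oriented segment
with vertices in `S` is the ordered pair of its two distinct endpoints (so every two-point subset
carries two oriented segments, one for each side of its line). Its positive side intersects
exactly `j` colors, none of which is a color of an endpoint, and the endpoints have exactly `c`
different colors. -/
def coloredFacets {S : Finset Plane} {m : ℕ} (κ : S → Fin m) (c j : ℕ) : Set (S × S) :=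
  {σ | σ.1 ≠ σ.2 ∧
    Disjoint (colorsMet κ (posSide σ.1 σ.2)) {κ σ.1, κ σ.2} ∧
    (colorsMet κ (posSide σ.1 σ.2)).ncard = j ∧
    ({κ σ.1, κ σ.2} : Set (Fin m)).ncard = c}

/-- The number `e_{c,j}(S)` of `c`-chromatic colored `j`-facets. -/
noncomputable def numFacets {S : Finset Plane} {m : ℕ} (κ : S → Fin m) (c j : ℕ) : ℕ :=
  (coloredFacets κ c j).ncard

end ColoredFacets

/-! With `K = k + 1`, the middle expression is a sum of weights over oriented segments
(`facetSum_univ`). Both bounds come from inductions that remove an extreme point `s`, or its whole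
color class.

Upper bound (`facetSum_upper`). Order the other points by slope around `s`. Scanned from either end,
the weights of the segments at `s` telescope: each new color raises `min K (colors seen)` to its
next value, and the first point of the color of `s` fills the total up to `K`, after which nothing
is added. So `s` accounts for `2K`, or for `2 * min K c` if its color is unique and `c` colors
remain. Deleting `s` never lowers the other weights.

Lower bound (`facetSum_lower`). Delete the class `a` of `s`. The sum at `K` for what remains is at
most the part of the sum at `K + 1` that avoids `a`, so it suffices to find two facets touching `a`
at each of `K + 1` levels: `K(K+1) + 2(K+1) = (K+1)(K+2)`. Rotate a direction and compare the
highest point of `a` with those of the other colors. Class `a` leads in the extreme direction of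
`s`. If in some direction `t + 1` colors lead `a`, then on the arc there and on the arc back `a`
ties with a color while exactly `t` are above: two bichromatic `t`-facets. Otherwise two hull edges
of `a` have at most `t` colors beyond them. -/

namespace ColoredFacets

open Finset
open scoped Classical

section

variable {α ι : Type*}

/-! ### Weighted facet sums -/

/-- Twice the signed area of the triangle `p q r`. -/
def cross (p q r : Plane) : ℝ :=
  (q 0 - p 0) * (r 1 - p 1) - (q 1 - p 1) * (r 0 - p 0)

lemma mem_posSide {p q r : Plane} : r ∈ posSide p q ↔ 0 < cross p q r := Iff.rfl

/-- An injective family of points, no three of which are collinear. -/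
structure GeneralPosition (x : α → Plane) : Prop where
  injective : Function.Injective x
  cross_ne_zero : ∀ p q r, p ≠ q → p ≠ r → q ≠ r → cross (x p) (x q) (x r) ≠ 0

/-- The colors of `T` on the positive side of the segment from `p` to `q`. -/
noncomputable def met (x : α → Plane) (κ : α → ι) (T : Finset α) (p q : α) : Finset ι :=
  (T.filter fun r => x r ∈ posSide (x p) (x q)).image κ

/-- The contribution of an oriented segment to the facet sum: bichromatic facets below level `K`
count once, monochromatic `j`-facets count `K - j` times. -/
noncomputable def weight (x : α → Plane) (κ : α → ι) (T : Finset α) (K : ℕ) (p q : α) : ℕ :=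
  if κ p ∉ met x κ T p q ∧ κ q ∉ met x κ T p q then
    if κ p = κ q then K - #(met x κ T p q) else if #(met x κ T p q) < K then 1 else 0
  else 0

/-- The weighted number of facets of the subfamily `T` below level `K`. -/
noncomputable def facetSum (x : α → Plane) (κ : α → ι) (T : Finset α) (K : ℕ) : ℕ :=
  ∑ σ ∈ T.offDiag, weight x κ T K σ.1 σ.2

/-- The colors occurring in `T`. -/
noncomputable def colors (κ : α → ι) (T : Finset α) : Finset ι := T.image κ

lemma mem_colors {κ : α → ι} {T : Finset α} {i : ι} : i ∈ colors κ T ↔ ∃ p ∈ T, κ p = i :=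
  mem_image

lemma mem_met {x : α → Plane} {κ : α → ι} {T : Finset α} {p q : α} {i : ι} :
    i ∈ met x κ T p q ↔ ∃ r ∈ T, 0 < cross (x p) (x q) (x r) ∧ κ r = i := by
  simp [met, mem_posSide, and_assoc]

lemma met_mono {x : α → Plane} {κ : α → ι} {T T' : Finset α} (h : T' ⊆ T) (p q : α) :
    met x κ T' p q ⊆ met x κ T p q :=
  image_subset_image (filter_subset_filter _ h)

/-- Extra points only enlarge the set of colors met, which can destroy a facet or raise its level,
and the weight decreases with the level. -/
lemma weight_anti {x : α → Plane} {κ : α → ι} {T T' : Finset α} (h : T' ⊆ T) (K : ℕ) (p q : α) :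
    weight x κ T K p q ≤ weight x κ T' K p q := by
  have h1 := met_mono (x := x) (κ := κ) h p q
  have h2 := card_le_card h1
  unfold weight
  split_ifs <;> first | omega | (exfalso; grind)

/-! ### Extreme points and the slope order around them -/

/-- Every nonempty finite family has a strictly extreme point in some direction. -/
lemma exists_extreme {x : α → Plane} (hx : Function.Injective x) {T : Finset α}
    (hT : T.Nonempty) :
    ∃ s ∈ T, ∃ v₀ v₁ : ℝ, ∀ p ∈ T, p ≠ s → v₀ * x p 0 + v₁ * x p 1 < v₀ * x s 0 + v₁ * x s 1 := by
  obtain ⟨s, hs, hmax⟩ := T.exists_max_image (fun p => x p 0 ^ 2 + x p 1 ^ 2) hT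
  -- For `s` farthest from the origin, its own position vector serves as direction.
  refine ⟨s, hs, x s 0, x s 1, fun p hp hps => ?_⟩
  have h1 := hmax p hp
  have h2 : 0 < (x p 0 - x s 0) ^ 2 + (x p 1 - x s 1) ^ 2 := by
    by_contra hcon
    apply hps
    apply hx
    have h0 : x p 0 - x s 0 = 0 := by nlinarith [sq_nonneg (x p 0 - x s 0), sq_nonneg (x p 1 - x s 1)]
    have h1 : x p 1 - x s 1 = 0 := by nlinarith [sq_nonneg (x p 0 - x s 0), sq_nonneg (x p 1 - x s 1)]
    ext i
    fin_cases i
    · exact sub_eq_zero.1 h0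
    · exact sub_eq_zero.1 h1
  simp only at h1
  nlinarith

/-- The points seen from an extreme point `s` are linearly ordered by slope. -/
lemma exists_slope {x : α → Plane} (hx : GeneralPosition x) {T : Finset α} {s : α} {v₀ v₁ : ℝ}
    (hs : ∀ p ∈ T, p ≠ s → v₀ * x p 0 + v₁ * x p 1 < v₀ * x s 0 + v₁ * x s 1) :
    ∃ h : α → ℝ, Set.InjOn h (T.erase s) ∧ ∀ p ∈ T.erase s, ∀ q ∈ T.erase s,
      (0 < cross (x s) (x p) (x q) ↔ h p < h q) ∧ (0 < cross (x p) (x s) (x q) ↔ h q < h p) := by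
  -- `d` is the depth below `s` in direction `v`, `c` the coordinate across it. As `d > 0` away from
  -- `s`, the quotient `-c / d` is a well-defined slope.
  let c : α → ℝ := fun p => v₀ * (x p 1 - x s 1) - v₁ * (x p 0 - x s 0)
  let d : α → ℝ := fun p => v₀ * (x s 0 - x p 0) + v₁ * (x s 1 - x p 1)
  have hd : ∀ p ∈ T.erase s, 0 < d p := by
    intro p hp
    have := hs p (mem_of_mem_erase hp) (ne_of_mem_erase hp)
    simp only [d]; linarith
  have key : ∀ p q, (v₀ ^ 2 + v₁ ^ 2) * cross (x s) (x p) (x q) = c p * d q - c q * d p := by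
    intro p q; simp only [cross, c, d]; ring
  have hv : ∀ p ∈ T.erase s, 0 < v₀ ^ 2 + v₁ ^ 2 := by
    intro p hp
    have hdp := hd p hp
    by_contra hcon
    have h0 : v₀ = 0 := by nlinarith [sq_nonneg v₀, sq_nonneg v₁]
    have h1 : v₁ = 0 := by nlinarith [sq_nonneg v₀, sq_nonneg v₁]
    simp [d, h0, h1] at hdp
  have hanti : ∀ p q, cross (x p) (x s) (x q) = - cross (x s) (x p) (x q) := by
    intro p q; simp only [cross]; ring
  have hlt : ∀ p ∈ T.erase s, ∀ q ∈ T.erase s,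
      (0 < cross (x s) (x p) (x q) ↔ - (c p / d p) < - (c q / d q)) := by
    intro p hp q hq
    rw [neg_lt_neg_iff, div_lt_div_iff₀ (hd q hq) (hd p hp), ← sub_pos (a := c p * d q), ← key,
      mul_pos_iff_of_pos_left (hv p hp)]
  have hgt : ∀ p ∈ T.erase s, ∀ q ∈ T.erase s,
      (0 < cross (x p) (x s) (x q) ↔ - (c q / d q) < - (c p / d p)) := by
    intro p hp q hq
    rw [neg_lt_neg_iff, div_lt_div_iff₀ (hd p hp) (hd q hq), hanti,
      ← mul_pos_iff_of_pos_left (hv p hp), mul_neg, key, neg_sub, sub_pos]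
  refine ⟨fun p => - (c p / d p), ?_, fun p hp q hq => ⟨hlt p hp q hq, hgt p hp q hq⟩⟩
  intro p hp q hq hpq
  by_contra hne
  have hp' : p ∈ T.erase s := hp
  have hq' : q ∈ T.erase s := hq
  have h1 := hlt p hp' q hq'
  have h2 := hgt p hp' q hq'
  simp only at hpq
  rw [hpq] at h1 h2
  rw [hanti] at h2
  have h3 := hx.cross_ne_zero s p q (ne_of_mem_erase hp').symm (ne_of_mem_erase hq').symm hne
  rcases lt_or_gt_of_ne h3 with h | h
  · exact lt_irrefl _ (h2.1 (by linarith))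
  · exact lt_irrefl _ (h1.1 h)

/-- Summing facet weights along a linear order of colored points. -/
lemma sum_ordered_weight (κ : α → ι) (a : ι) (K : ℕ) (R : Finset α) (h : α → ℝ)
    (hinj : Set.InjOn h R) :
    ∑ q ∈ R, (if a ∉ (R.filter fun r => h q < h r).image κ ∧
        κ q ∉ (R.filter fun r => h q < h r).image κ then
      if a = κ q then K - #((R.filter fun r => h q < h r).image κ)
        else if #((R.filter fun r => h q < h r).image κ) < K then 1 else 0
      else 0) = if a ∈ colors κ R then K else min K #(colors κ R) := by
  induction R using Finset.induction_on_min_value h with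
  | empty => simp [colors]
  | insert p R hp hmin ih =>
    have hlt : ∀ r ∈ R, h p < h r := fun r hr =>
      lt_of_le_of_ne (hmin r hr) fun e =>
        hp (hinj (mem_coe.2 (mem_insert_self p R)) (mem_coe.2 (mem_insert_of_mem hr)) e ▸ hr)
    have hself : ((insert p R).filter fun r => h p < h r) = R := by
      ext r; simp only [mem_filter, mem_insert]
      constructor
      · rintro ⟨rfl | hr, h2⟩
        · exact absurd h2 (lt_irrefl _)
        · exact hr
      · exact fun hr => ⟨Or.inr hr, hlt r hr⟩
    have hother : ∀ q ∈ R, ((insert p R).filter fun r => h q < h r)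
        = R.filter fun r => h q < h r := by
      intro q hq
      rw [filter_insert, if_neg (not_lt.2 (hmin q hq))]
    rw [sum_insert hp, hself, sum_congr rfl (fun q hq => by rw [hother q hq]),
      ih (hinj.mono (by simp))]
    have hc : colors κ (insert p R) = insert (κ p) (colors κ R) := by simp [colors, image_insert]
    rw [hc]
    -- The lowest point sees all of `R` and is seen by no other. If `a` and its color are both
    -- absent from `R`, it adds the missing `K - min K #` when its color is `a`, and otherwise the
    -- increment of `min K #`.
    change (if a ∉ colors κ R ∧ κ p ∉ colors κ R then
      if a = κ p then K - #(colors κ R) else if #(colors κ R) < K then 1 else 0 else 0) + _ = _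
    by_cases h1 : a ∈ colors κ R
    · simp [h1]
    · by_cases h2 : κ p ∈ colors κ R
      · simp [h1, h2]
      · by_cases h3 : a = κ p
        · subst h3; simp [h1]
        · simp only [h1, h2, h3, mem_insert, card_insert_of_notMem h2]
          simp
          split_ifs <;> omega

lemma met_eq_image_slope_left {x : α → Plane} {κ : α → ι} {T : Finset α} {s : α} {h : α → ℝ}
    (hh : ∀ p ∈ T.erase s, ∀ q ∈ T.erase s,
      (0 < cross (x s) (x p) (x q) ↔ h p < h q) ∧ (0 < cross (x p) (x s) (x q) ↔ h q < h p))
    {q : α} (hq : q ∈ T.erase s) :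
    met x κ T s q = ((T.erase s).filter fun r => h q < h r).image κ := by
  unfold met
  congr 1
  ext r
  rw [mem_filter, mem_filter, mem_posSide]
  by_cases hr : r = s
  · subst hr; simp [cross]
  · constructor
    · rintro ⟨h1, h2⟩
      exact ⟨mem_erase.2 ⟨hr, h1⟩, (hh q hq r (mem_erase.2 ⟨hr, h1⟩)).1.1 h2⟩
    · rintro ⟨h1, h2⟩
      exact ⟨mem_of_mem_erase h1, (hh q hq r h1).1.2 h2⟩

lemma met_eq_image_slope_right {x : α → Plane} {κ : α → ι} {T : Finset α} {s : α} {h : α → ℝ}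
    (hh : ∀ p ∈ T.erase s, ∀ q ∈ T.erase s,
      (0 < cross (x s) (x p) (x q) ↔ h p < h q) ∧ (0 < cross (x p) (x s) (x q) ↔ h q < h p))
    {q : α} (hq : q ∈ T.erase s) :
    met x κ T q s = ((T.erase s).filter fun r => -h q < -h r).image κ := by
  unfold met
  congr 1
  ext r
  rw [mem_filter, mem_filter, mem_posSide, neg_lt_neg_iff]
  by_cases hr : r = s
  · subst hr; simp [cross, mul_comm]
  · constructor
    · rintro ⟨h1, h2⟩
      exact ⟨mem_erase.2 ⟨hr, h1⟩, (hh q hq r (mem_erase.2 ⟨hr, h1⟩)).2.1 h2⟩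
    · rintro ⟨h1, h2⟩
      exact ⟨mem_of_mem_erase h1, (hh q hq r h1).2.2 h2⟩

/-- The total weight of the segments ending at an extreme point. -/
lemma sum_weight_extreme {x : α → Plane} (hx : GeneralPosition x) (κ : α → ι) {T : Finset α}
    {s : α} {v₀ v₁ : ℝ}
    (hs : ∀ p ∈ T, p ≠ s → v₀ * x p 0 + v₁ * x p 1 < v₀ * x s 0 + v₁ * x s 1) (K : ℕ) :
    ∑ q ∈ T.erase s, (weight x κ T K s q + weight x κ T K q s) =
      2 * if κ s ∈ colors κ (T.erase s) then K else min K #(colors κ (T.erase s)) := by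
  obtain ⟨h, hinj, hh⟩ := exists_slope hx hs
  have h1 := sum_ordered_weight κ (κ s) K (T.erase s) h hinj
  -- Segments directed into `s` see the reversed slope order.
  have h2 := sum_ordered_weight κ (κ s) K (T.erase s) (fun q => -h q)
    (fun p hp q hq e => hinj hp hq (neg_injective e))
  rw [sum_add_distrib, two_mul]
  congr 1
  · rw [← h1]
    refine sum_congr rfl fun q hq => ?_
    rw [weight, met_eq_image_slope_left hh hq]
  · rw [← h2]
    refine sum_congr rfl fun q hq => ?_
    rw [weight, met_eq_image_slope_right hh hq]
    simp only [and_comm, eq_comm]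

/-! ### Upper bound: deleting an extreme point -/

lemma facetSum_le_erase (x : α → Plane) (κ : α → ι) {T : Finset α} {s : α} (hs : s ∈ T) (K : ℕ) :
    facetSum x κ T K ≤ facetSum x κ (T.erase s) K +
      ∑ q ∈ T.erase s, (weight x κ T K s q + weight x κ T K q s) := by
  have hT : T.offDiag = (T.erase s).offDiag ∪ {s} ×ˢ (T.erase s) ∪ (T.erase s) ×ˢ {s} := by
    conv_lhs => rw [← insert_erase hs]
    rw [offDiag_insert (notMem_erase s T)]
  unfold facetSum
  have hd1 : Disjoint (T.erase s).offDiag ({s} ×ˢ T.erase s) := by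
    rw [disjoint_left]; rintro ⟨p, q⟩ h1 h2
    simp only [mem_offDiag, mem_product, mem_singleton, mem_erase] at h1 h2
    exact h1.1.1 h2.1
  have hd2 : Disjoint ((T.erase s).offDiag ∪ {s} ×ˢ T.erase s) (T.erase s ×ˢ {s}) := by
    rw [disjoint_left]; rintro ⟨p, q⟩ h1 h2
    simp only [mem_union, mem_offDiag, mem_product, mem_singleton, mem_erase] at h1 h2
    rcases h1 with h1 | h1
    · exact h1.2.1.1 h2.2
    · exact h2.1.1 h1.1
  rw [hT, sum_union hd2, sum_union hd1, sum_add_distrib, sum_product, sum_singleton,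
    sum_product_right, sum_singleton, add_assoc]
  exact Nat.add_le_add_right (sum_le_sum fun σ _ => weight_anti (erase_subset s T) K _ _) _

/-- Upper bound for the weighted facet count. -/
theorem facetSum_upper {x : α → Plane} (hx : GeneralPosition x) (κ : α → ι) (K : ℕ)
    (T : Finset α) :
    facetSum x κ T K + K * (K + 1) ≤
      2 * #T * K + (K - #(colors κ T)) * (K - #(colors κ T) + 1) := by
  induction hn : #T generalizing T with
  | zero =>
    rw [card_eq_zero] at hn
    subst hn
    simp [facetSum, colors]
  | succ n ih =>
    obtain ⟨s, hsT, v₀, v₁, hs⟩ := exists_extreme hx.injective (card_pos.1 (by omega : 0 < #T))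
    have hcard : #(T.erase s) = n := by rw [card_erase_of_mem hsT]; omega
    have h1 := ih (T.erase s) hcard
    have h2 := facetSum_le_erase x κ hsT K
    rw [sum_weight_extreme hx κ hs K] at h2
    have hc : colors κ T = insert (κ s) (colors κ (T.erase s)) := by
      conv_lhs => rw [← insert_erase hsT]
      simp [colors, image_insert]
    split_ifs at h2 with hmem
    · rw [hc, insert_eq_of_mem hmem]
      linarith
    · rw [hc, card_insert_of_notMem hmem]
      set c := #(colors κ (T.erase s))
      -- A new color lowers the quadratic term by `2 * (K - c)`, exactly the shortfall of `2 * min K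
      -- c` from `2 * K`; for `c ≥ K` both vanish.
      rcases Nat.lt_or_ge c K with hlt | hge
      · obtain ⟨r, hr⟩ := Nat.exists_eq_add_of_lt hlt
        have e1 : K - c = r + 1 := by omega
        have e2 : K - (c + 1) = r := by omega
        have e3 : min K c = c := by omega
        rw [e1] at h1
        rw [e2]
        rw [e3] at h2
        nlinarith
      · have e1 : K - c = 0 := by omega
        have e2 : K - (c + 1) = 0 := by omega
        have e3 : min K c = K := by omega
        rw [e1] at h1
        rw [e2]
        rw [e3] at h2
        linarith

/-! ### Decomposition into levels -/

/-- A facet counted at level `t`: a bichromatic `t`-facet, or a monochromatic `j`-facet with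
`j ≤ t`. -/
def LevelFacet (x : α → Plane) (κ : α → ι) (T : Finset α) (t : ℕ) (p q : α) : Prop :=
  κ p ∉ met x κ T p q ∧ κ q ∉ met x κ T p q ∧
    ((κ p = κ q ∧ #(met x κ T p q) ≤ t) ∨ (κ p ≠ κ q ∧ #(met x κ T p q) = t))

/-- A monochromatic `j`-facet is present on the levels `j, ..., K - 1`, hence its multiplicity `K -
j`. -/
lemma weight_eq_sum (x : α → Plane) (κ : α → ι) (T : Finset α) (K : ℕ) (p q : α) :
    weight x κ T K p q = ∑ t ∈ range K, if LevelFacet x κ T t p q then 1 else 0 := by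
  rw [← card_filter]
  unfold weight
  by_cases h : κ p ∉ met x κ T p q ∧ κ q ∉ met x κ T p q
  · by_cases h' : κ p = κ q
    · have : (range K).filter (fun t => LevelFacet x κ T t p q) = Ico #(met x κ T p q) K := by
        ext t; simp only [mem_filter, mem_range, mem_Ico]; unfold LevelFacet; tauto
      rw [this, Nat.card_Ico, if_pos h, if_pos h']
    · rw [if_pos h, if_neg h']
      have : (range K).filter (fun t => LevelFacet x κ T t p q) =
          if #(met x κ T p q) < K then {#(met x κ T p q)} else ∅ := by
        ext t
        split_ifs with h3
        · simp only [mem_filter, mem_range, mem_singleton]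
          unfold LevelFacet
          constructor
          · tauto
          · rintro rfl; tauto
        · simp only [mem_filter, mem_range, notMem_empty, iff_false]
          unfold LevelFacet
          rintro ⟨h4, -, -, h5 | h5⟩
          · exact h' h5.1
          · omega
      rw [this]
      split_ifs <;> simp
  · rw [if_neg h, eq_comm, card_eq_zero, filter_eq_empty_iff]
    simp only [LevelFacet]
    tauto

/-! ### Rotating directions and ties between colors -/

/-- The height of the `p`-th point in the direction of angle `θ`. -/
noncomputable def height (x : α → Plane) (θ : ℝ) (p : α) : ℝ :=
  Real.cos θ * x p 0 + Real.sin θ * x p 1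

lemma continuous_height (x : α → Plane) (p : α) : Continuous fun θ => height x θ p := by
  unfold height; fun_prop

/-- The colors other than `a` whose highest point is above the color class `a`. -/
noncomputable def above (x : α → Plane) (κ : α → ι) (T : Finset α) (a : ι) (θ : ℝ) : Finset ι :=
  ((colors κ T).erase a).filter fun b =>
    ∃ q ∈ T, κ q = b ∧ ∀ p ∈ T, κ p = a → height x θ p < height x θ q

/-- The colors other than `a` whose highest point is below the highest point of color `a`. -/
noncomputable def below (x : α → Plane) (κ : α → ι) (T : Finset α) (a : ι) (θ : ℝ) : Finset ι :=
  ((colors κ T).erase a).filter fun b =>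
    ∃ p ∈ T, κ p = a ∧ ∀ q ∈ T, κ q = b → height x θ q < height x θ p

lemma disjoint_above_below (x : α → Plane) (κ : α → ι) (T : Finset α) (a : ι) (θ : ℝ) :
    Disjoint (above x κ T a θ) (below x κ T a θ) := by
  rw [disjoint_left]
  intro b h1 h2
  obtain ⟨-, q, hq, hqb, h1⟩ := mem_filter.1 h1
  obtain ⟨-, p, hp, hpa, h2⟩ := mem_filter.1 h2
  exact lt_asymm (h1 p hp hpa) (h2 q hq hqb)

lemma card_above_add_card_below_le (x : α → Plane) (κ : α → ι) (T : Finset α) (a : ι) (θ : ℝ) :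
    #(above x κ T a θ) + #(below x κ T a θ) ≤ #((colors κ T).erase a) := by
  rw [← card_union_of_disjoint (disjoint_above_below x κ T a θ)]
  exact card_le_card (union_subset (filter_subset _ _) (filter_subset _ _))

/-- Finitely many open conditions that hold at `θ` persist nearby, so the count is lower
semicontinuous. -/
lemma isOpen_le_card_filter {β : Type*} (C : Finset β) (P : β → ℝ → Prop)
    [∀ θ, DecidablePred fun b => P b θ] (hP : ∀ b, IsOpen {θ | P b θ}) (n : ℕ) :
    IsOpen {θ | n ≤ #(C.filter fun b => P b θ)} := by
  rw [isOpen_iff_mem_nhds]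
  intro θ hθ
  have h : ∀ᶠ θ' in nhds θ, ∀ b ∈ C.filter fun b => P b θ, P b θ' := by
    rw [Filter.eventually_all_finset]
    intro b hb
    exact (hP b).mem_nhds (mem_filter.1 hb).2
  filter_upwards [h] with θ' h'
  refine le_trans (show n ≤ _ from hθ) (card_le_card fun b hb => ?_)
  exact mem_filter.2 ⟨(mem_filter.1 hb).1, h' b hb⟩

lemma isOpen_exists_forall_lt (x : α → Plane) (T : Finset α) (P Q : α → Prop) :
    IsOpen {θ | ∃ q ∈ T, P q ∧ ∀ p ∈ T, Q p → height x θ p < height x θ q} := by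
  have : {θ | ∃ q ∈ T, P q ∧ ∀ p ∈ T, Q p → height x θ p < height x θ q} =
      ⋃ q ∈ T.filter P, ⋂ p ∈ T.filter Q, {θ | height x θ p < height x θ q} := by
    ext θ; simp [and_assoc]
  rw [this]
  refine isOpen_biUnion fun q _ => isOpen_biInter_finset fun p _ => ?_
  exact isOpen_lt (continuous_height x p) (continuous_height x q)

lemma exists_polar (v₀ v₁ : ℝ) (h : v₀ ≠ 0 ∨ v₁ ≠ 0) :
    ∃ θ μ : ℝ, 0 < μ ∧ v₀ = μ * Real.cos θ ∧ v₁ = μ * Real.sin θ := by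
  refine ⟨Complex.arg ⟨v₀, v₁⟩, ‖(⟨v₀, v₁⟩ : ℂ)‖, ?_, ?_, ?_⟩
  · rw [norm_pos_iff]
    intro h0
    rw [Complex.ext_iff] at h0
    simp at h0
    tauto
  · rw [Complex.norm_mul_cos_arg]
  · rw [Complex.norm_mul_sin_arg]

/-- The vector `(sin θ, -cos θ)` has `(cos θ, sin θ)` as left normal, so for `μ > 0` the positive
side is the upper side. -/
lemma cross_eq_height {x : α → Plane} {p q : α} {θ μ : ℝ}
    (h0 : x q 0 - x p 0 = μ * Real.sin θ) (h1 : x q 1 - x p 1 = -(μ * Real.cos θ)) (r : α) :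
    cross (x p) (x q) (x r) = μ * (height x θ r - height x θ p) := by
  simp only [cross, height, h0, h1]; ring

/-- A direction in which the class `a` ties with another color yields a facet. -/
lemma exists_facet_of_tie {x : α → Plane} (hx : GeneralPosition x) {κ : α → ι} {T : Finset α}
    {a : ι} (ha : a ∈ colors κ T) {t : ℕ} {θ : ℝ} (h1 : #(above x κ T a θ) ≤ t)
    (h2 : #(below x κ T a θ) + t < #((colors κ T).erase a)) :
    ∃ σ ∈ T.offDiag, (κ σ.1 = a ∨ κ σ.2 = a) ∧ LevelFacet x κ T t σ.1 σ.2 ∧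
      ∃ μ : ℝ, 0 < μ ∧ x σ.2 0 - x σ.1 0 = μ * Real.sin θ ∧
        x σ.2 1 - x σ.1 1 = -(μ * Real.cos θ) := by
  have hsup : ∀ b ∈ colors κ T, ∃ p ∈ T, κ p = b ∧ ∀ q ∈ T, κ q = b →
      height x θ q ≤ height x θ p := by
    intro b hb
    obtain ⟨r, hr, hrb⟩ := mem_image.1 hb
    obtain ⟨p, hp, hmax⟩ := (T.filter fun p => κ p = b).exists_max_image (height x θ)
      ⟨r, mem_filter.2 ⟨hr, hrb⟩⟩
    exact ⟨p, (mem_filter.1 hp).1, (mem_filter.1 hp).2,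
      fun q hq hqb => hmax q (mem_filter.2 ⟨hq, hqb⟩)⟩
  obtain ⟨p, hpT, hpa, hp⟩ := hsup a ha
  have habove : ∀ b, b ∈ above x κ T a θ ↔ b ≠ a ∧ ∃ q ∈ T, κ q = b ∧
      height x θ p < height x θ q := by
    intro b
    constructor
    · intro h
      obtain ⟨hb, q, hq, hqb, h⟩ := mem_filter.1 h
      exact ⟨ne_of_mem_erase hb, q, hq, hqb, h p hpT hpa⟩
    · rintro ⟨hb, q, hq, hqb, h⟩
      refine mem_filter.2 ⟨mem_erase.2 ⟨hb, mem_image.2 ⟨q, hq, hqb⟩⟩, q, hq, hqb, ?_⟩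
      exact fun p' hp' hpa' => (hp p' hp' hpa').trans_lt h
  have htie : ∀ b ∈ (colors κ T).erase a, b ∉ above x κ T a θ → b ∉ below x κ T a θ →
      ∃ q ∈ T, κ q = b ∧ height x θ q = height x θ p := by
    intro b hb hb1 hb2
    obtain ⟨q, hqT, hqb, hq⟩ := hsup b (mem_of_mem_erase hb)
    refine ⟨q, hqT, hqb, le_antisymm ?_ ?_⟩
    · by_contra hcon
      exact hb1 ((habove b).2 ⟨ne_of_mem_erase hb, q, hqT, hqb, not_le.1 hcon⟩)
    · by_contra hcon
      exact hb2 (mem_filter.2 ⟨hb, p, hpT, hpa,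
        fun q' hq' hqb' => (hq q' hq' hqb').trans_lt (not_le.1 hcon)⟩)
  obtain ⟨b, hb, hbn⟩ : ∃ b ∈ (colors κ T).erase a, b ∉ above x κ T a θ ∪ below x κ T a θ := by
    by_contra! hcon
    have := card_le_card (show (colors κ T).erase a ⊆ _ from hcon)
    have := card_union_le (above x κ T a θ) (below x κ T a θ)
    omega
  rw [mem_union, not_or] at hbn
  obtain ⟨q, hqT, hqb, hq⟩ := htie b hb hbn.1 hbn.2
  have hba : b ≠ a := ne_of_mem_erase hb
  have hpq : p ≠ q := by rintro rfl; exact hba (hqb.symm.trans hpa)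
  set d₀ := x q 0 - x p 0 with hd₀
  set d₁ := x q 1 - x p 1 with hd₁
  set μ := d₀ * Real.sin θ - d₁ * Real.cos θ with hμ
  have horth : Real.cos θ * d₀ + Real.sin θ * d₁ = 0 := by
    simp only [height] at hq; rw [hd₀, hd₁]; linarith
  have hcs := Real.sin_sq_add_cos_sq θ
  have e0 : d₀ = μ * Real.sin θ := by
    rw [hμ]; linear_combination (-d₀) * hcs + Real.cos θ * horth
  have e1 : d₁ = -(μ * Real.cos θ) := by
    rw [hμ]; linear_combination (-d₁) * hcs + Real.sin θ * horth
  have hcross := cross_eq_height (x := x) e0 e1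
  have hμ0 : μ ≠ 0 := by
    intro h0
    rw [h0] at e0 e1
    apply hpq
    apply hx.injective
    ext i
    fin_cases i
    · simp only [Fin.zero_eta]; linarith
    · simp only [Fin.mk_one]; linarith
  have hba' : b ∉ above x κ T a θ := hbn.1
  have haa : a ∉ above x κ T a θ := fun h => ((habove a).1 h).1 rfl
  have hcard : #(above x κ T a θ) = t := by
    refine le_antisymm h1 ?_
    -- A second tied color would put three points at one height, hence on one line. So only `b`
    -- ties, which forces at least `t` colors above.
    have hsub : (colors κ T).erase a ⊆ insert b (above x κ T a θ ∪ below x κ T a θ) := by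
      intro c hc
      by_contra hcon
      rw [mem_insert, mem_union, not_or, not_or] at hcon
      obtain ⟨r, hrT, hrc, hr⟩ := htie c hc hcon.2.1 hcon.2.2
      refine hx.cross_ne_zero p q r hpq ?_ ?_ ?_
      · rintro rfl; exact ne_of_mem_erase hc (hrc.symm.trans hpa)
      · rintro rfl; exact hcon.1 (hrc.symm.trans hqb)
      · rw [hcross, hr, sub_self, mul_zero]
    have := card_le_card hsub
    have := card_insert_le b (above x κ T a θ ∪ below x κ T a θ)
    have := card_union_le (above x κ T a θ) (below x κ T a θ)
    omega
  have hmet : ∀ σ : α × α, (∀ r, 0 < cross (x σ.1) (x σ.2) (x r) ↔ height x θ p < height x θ r) →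
      met x κ T σ.1 σ.2 = above x κ T a θ := by
    intro σ hσ
    ext c
    rw [mem_met, habove]
    simp only [hσ]
    constructor
    · rintro ⟨r, hr, h, rfl⟩
      exact ⟨fun hc => not_lt.2 (hp r hr hc) h, r, hr, rfl, h⟩
    · rintro ⟨-, r, hr, hc, h⟩
      exact ⟨r, hr, h, hc⟩
  -- The sign of `μ` decides which orientation has its positive side upward.
  rcases lt_or_gt_of_ne hμ0 with hneg | hpos
  · refine ⟨(q, p), mem_offDiag.2 ⟨hqT, hpT, hpq.symm⟩, Or.inr hpa, ?_, -μ, by linarith, ?_, ?_⟩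
    · have := hmet (q, p) (fun r => by
        have : cross (x q) (x p) (x r) = - cross (x p) (x q) (x r) := by simp only [cross]; ring
        simp only
        rw [this, hcross, ← neg_mul, mul_pos_iff_of_pos_left (by linarith), sub_pos])
      simp only at this
      refine ⟨?_, ?_, Or.inr ⟨?_, ?_⟩⟩ <;> simp only [this, hpa, hqb] <;> assumption
    · simp only; linarith
    · simp only; linarith
  · refine ⟨(p, q), mem_offDiag.2 ⟨hpT, hqT, hpq⟩, Or.inl hpa, ?_, μ, hpos, e0, e1⟩
    have := hmet (p, q) (fun r => by
        simp only
        rw [hcross, mul_pos_iff_of_pos_left hpos, sub_pos])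
    simp only at this
    refine ⟨?_, ?_, Or.inr ⟨?_, ?_⟩⟩ <;> simp only [this, hpa, hqb] <;>
      first | assumption | exact hba.symm

/-- Between a direction where few colors are above `a` and one where many are, some color ties. -/
lemma exists_tie {x : α → Plane} {κ : α → ι} {T : Finset α} {a : ι} {t : ℕ} {θ₀ θ₁ l u : ℝ}
    (h₀ : θ₀ ∈ Set.Icc l u) (h₁ : θ₁ ∈ Set.Icc l u)
    (hlow : #((colors κ T).erase a) ≤ #(below x κ T a θ₀) + t)
    (hhigh : t + 1 ≤ #(above x κ T a θ₁)) :
    ∃ θ ∈ Set.Icc l u, #(above x κ T a θ) ≤ t ∧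
      #(below x κ T a θ) + t < #((colors κ T).erase a) := by
  by_contra! hcon
  have hU : IsOpen {θ | t + 1 ≤ #(above x κ T a θ)} :=
    isOpen_le_card_filter ((colors κ T).erase a) (fun b θ => ∃ q ∈ T, κ q = b ∧
      ∀ p ∈ T, κ p = a → height x θ p < height x θ q)
      (fun b => isOpen_exists_forall_lt x T (fun q => κ q = b) (fun p => κ p = a)) (t + 1)
  have hV : IsOpen {θ | #((colors κ T).erase a) - t ≤ #(below x κ T a θ)} :=
    isOpen_le_card_filter ((colors κ T).erase a) (fun b θ => ∃ p ∈ T, κ p = a ∧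
      ∀ q ∈ T, κ q = b → height x θ q < height x θ p)
      (fun b => isOpen_exists_forall_lt x T (fun p => κ p = a) (fun q => κ q = b)) _
  -- Without a tie the two open sets would cover the interval. Each meets it, so by connectedness
  -- they share a point, but above and below are disjoint sets of colors.
  obtain ⟨θ, -, h1, h2⟩ := isPreconnected_Icc (a := l) (b := u) _ _ hU hV
    (fun θ hθ => by
      by_cases h : #(above x κ T a θ) ≤ t
      · right; have := hcon θ hθ h; simp only [Set.mem_ofPred_eq]; omega
      · left; simp only [Set.mem_ofPred_eq]; omega)
    ⟨θ₁, h₁, hhigh⟩ ⟨θ₀, h₀, by simp only [Set.mem_ofPred_eq]; omega⟩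
  have := card_above_add_card_below_le x κ T a θ
  simp only [Set.mem_ofPred_eq] at h1 h2
  omega

/-- A color class with two points has two hull edges, as oriented segments. -/
lemma exists_two_hull_edges {x : α → Plane} (hx : GeneralPosition x) {κ : α → ι} {T : Finset α}
    {a : ι} (h : 1 < #(T.filter fun p => κ p = a)) :
    ∃ σ ∈ T.offDiag, ∃ τ ∈ T.offDiag, σ ≠ τ ∧
      (κ σ.1 = a ∧ κ σ.2 = a ∧ a ∉ met x κ T σ.1 σ.2) ∧
      (κ τ.1 = a ∧ κ τ.2 = a ∧ a ∉ met x κ T τ.1 τ.2) := by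
  set A := T.filter fun p => κ p = a with hA
  obtain ⟨s, hs, v₀, v₁, hv⟩ := exists_extreme hx.injective (card_pos.1 (zero_lt_one.trans h))
  obtain ⟨h, -, hh⟩ := exists_slope hx hv
  have hne : (A.erase s).Nonempty := by
    rw [← card_pos, card_erase_of_mem hs]; omega
  -- The points of extreme slope seen from `s` are its hull neighbors within the class.
  obtain ⟨q, hq, hmax⟩ := (A.erase s).exists_max_image h hne
  obtain ⟨r, hr, hmin⟩ := (A.erase s).exists_min_image h hne
  have hA' : ∀ {p}, p ∈ A ↔ p ∈ T ∧ κ p = a := mem_filter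
  have hsA := hA'.1 hs
  have hqA := hA'.1 (mem_of_mem_erase hq)
  have hrA := hA'.1 (mem_of_mem_erase hr)
  refine ⟨(s, q), mem_offDiag.2 ⟨hsA.1, hqA.1, (ne_of_mem_erase hq).symm⟩,
    (r, s), mem_offDiag.2 ⟨hrA.1, hsA.1, ne_of_mem_erase hr⟩, ?_, ⟨hsA.2, hqA.2, ?_⟩,
    ⟨hrA.2, hsA.2, ?_⟩⟩
  · intro e
    exact ne_of_mem_erase hr (Prod.ext_iff.1 e).1.symm
  · rw [mem_met]
    rintro ⟨p, hp, hpos, hpa⟩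
    by_cases hps : p = s
    · subst hps; simp [cross] at hpos
    · have hpA : p ∈ A.erase s := mem_erase.2 ⟨hps, hA'.2 ⟨hp, hpa⟩⟩
      exact not_lt.2 (hmax p hpA) ((hh q hq p hpA).1.1 hpos)
  · rw [mem_met]
    rintro ⟨p, hp, hpos, hpa⟩
    by_cases hps : p = s
    · subst hps; simp [cross, mul_comm] at hpos
    · have hpA : p ∈ A.erase s := mem_erase.2 ⟨hps, hA'.2 ⟨hp, hpa⟩⟩
      exact not_lt.2 (hmin p hpA) ((hh r hr p hpA).2.1 hpos)

/-- The colors beyond a hull edge of class `a` are above `a` in the normal direction. -/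
lemma exists_met_subset_above {x : α → Plane} (hx : GeneralPosition x) {κ : α → ι}
    {T : Finset α} {a : ι} {p q : α} (hpq : p ≠ q) (ha : a ∉ met x κ T p q) :
    ∃ θ, met x κ T p q ⊆ above x κ T a θ := by
  have hne : -(x q 1 - x p 1) ≠ 0 ∨ x q 0 - x p 0 ≠ 0 := by
    by_contra! hcon
    apply hpq
    apply hx.injective
    ext i
    fin_cases i
    · simp only [Fin.zero_eta]; linarith
    · simp only [Fin.mk_one]; linarith
  obtain ⟨θ, μ, hμ, e1, e0⟩ := exists_polar _ _ hne
  have hcross := cross_eq_height (x := x) e0 (by linarith : x q 1 - x p 1 = -(μ * Real.cos θ))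
  refine ⟨θ, fun c hc => ?_⟩
  have hca : c ≠ a := by rintro rfl; exact ha hc
  obtain ⟨r, hr, hpos, hrc⟩ := mem_met.1 hc
  refine mem_filter.2 ⟨mem_erase.2 ⟨hca, mem_image.2 ⟨r, hr, hrc⟩⟩, r, hr, hrc, fun s hs hsa => ?_⟩
  rw [hcross, mul_pos_iff_of_pos_left hμ, sub_pos] at hpos
  refine lt_of_le_of_lt ?_ hpos
  by_contra hcon
  refine ha (mem_met.2 ⟨s, hs, ?_, hsa⟩)
  rw [hcross, mul_pos_iff_of_pos_left hμ, sub_pos]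
  exact not_le.1 hcon

/-- Every level carries two facets that touch the color of an extreme point. -/
lemma exists_two_facets {x : α → Plane} (hx : GeneralPosition x) {κ : α → ι} {T : Finset α}
    {s : α} (hsT : s ∈ T) {v₀ v₁ : ℝ}
    (hs : ∀ p ∈ T, p ≠ s → v₀ * x p 0 + v₁ * x p 1 < v₀ * x s 0 + v₁ * x s 1) {t : ℕ}
    (ht : t + 2 ≤ #(colors κ T)) :
    ∃ σ ∈ T.offDiag, ∃ τ ∈ T.offDiag, σ ≠ τ ∧
      ((κ σ.1 = κ s ∨ κ σ.2 = κ s) ∧ LevelFacet x κ T t σ.1 σ.2) ∧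
      ((κ τ.1 = κ s ∨ κ τ.2 = κ s) ∧ LevelFacet x κ T t τ.1 τ.2) := by
  have ha : κ s ∈ colors κ T := mem_image_of_mem κ hsT
  have hC : #((colors κ T).erase (κ s)) + 1 = #(colors κ T) := card_erase_add_one ha
  -- For a single point `hs` is vacuous and allows the zero vector; a second color rules this out.
  have hv : v₀ ≠ 0 ∨ v₁ ≠ 0 := by
    obtain ⟨b, hb⟩ : ((colors κ T).erase (κ s)).Nonempty := by rw [← card_pos]; omega
    obtain ⟨p, hp, hpb⟩ := mem_image.1 (mem_of_mem_erase hb)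
    have hps : p ≠ s := by rintro rfl; exact ne_of_mem_erase hb hpb.symm
    by_contra! hcon
    have := hs p hp hps
    simp [hcon.1, hcon.2] at this
  obtain ⟨θ₀, μ, hμ, e0, e1⟩ := exists_polar v₀ v₁ hv
  have hs' : ∀ p ∈ T, p ≠ s → height x θ₀ p < height x θ₀ s := by
    intro p hp hps
    have := hs p hp hps
    rw [e0, e1] at this
    simp only [height]
    nlinarith
  by_cases hcase : ∃ θ₁, t + 1 ≤ #(above x κ T (κ s) θ₁)
  · obtain ⟨θ₁', hθ₁'⟩ := hcase
    obtain ⟨θ₁, hmem, hθ₁⟩ : ∃ θ₁ ∈ Set.Ico θ₀ (θ₀ + 2 * Real.pi),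
        t + 1 ≤ #(above x κ T (κ s) θ₁) := by
      refine ⟨toIcoMod Real.two_pi_pos θ₀ θ₁', toIcoMod_mem_Ico _ _ _, ?_⟩
      have : above x κ T (κ s) (toIcoMod Real.two_pi_pos θ₀ θ₁') = above x κ T (κ s) θ₁' := by
        have hh : ∀ p, height x (toIcoMod Real.two_pi_pos θ₀ θ₁') p = height x θ₁' p := by
          intro p
          simp only [height, toIcoMod, zsmul_eq_mul, Real.cos_sub_int_mul_two_pi,
            Real.sin_sub_int_mul_two_pi]
        simp only [above, hh]
      rwa [this]
    have hbelow : ∀ θ, (∀ p, height x θ p = height x θ₀ p) →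
        #((colors κ T).erase (κ s)) ≤ #(below x κ T (κ s) θ) + t := by
      intro θ hθ
      refine le_trans (card_le_card fun b hb => ?_) (Nat.le_add_right _ _)
      refine mem_filter.2 ⟨hb, s, hsT, rfl, fun q hq hqb => ?_⟩
      rw [hθ, hθ]
      refine hs' q hq ?_
      rintro rfl; exact ne_of_mem_erase hb hqb.symm
    have hper : ∀ p, height x (θ₀ + 2 * Real.pi) p = height x θ₀ p := by
      intro p; simp [height]
    obtain ⟨θ, hθ, hθa, hθb⟩ := exists_tie (Set.left_mem_Icc.2 hmem.1)
      (Set.right_mem_Icc.2 hmem.1) (hbelow θ₀ fun _ => rfl) hθ₁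
    obtain ⟨φ, hφ, hφa, hφb⟩ := exists_tie (Set.right_mem_Icc.2 hmem.2.le)
      (Set.left_mem_Icc.2 hmem.2.le) (hbelow _ hper) hθ₁
    obtain ⟨σ, hσ, hσa, hσl, μ₁, hμ₁, h10, h11⟩ := exists_facet_of_tie hx ha hθa hθb
    obtain ⟨τ, hτ, hτa, hτl, μ₂, hμ₂, h20, h21⟩ := exists_facet_of_tie hx ha hφa hφb
    refine ⟨σ, hσ, τ, hτ, ?_, ⟨hσa, hσl⟩, ⟨hτa, hτl⟩⟩
    rintro rfl
    have hsin : μ₁ * Real.sin θ = μ₂ * Real.sin φ := h10.symm.trans h20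
    have hcos : μ₁ * Real.cos θ = μ₂ * Real.cos φ := neg_injective (h11.symm.trans h21)
    have hμ12 : μ₁ = μ₂ := by
      have h1 := Real.sin_sq_add_cos_sq θ
      have h2 := Real.sin_sq_add_cos_sq φ
      have : μ₁ ^ 2 = μ₂ ^ 2 := by
        linear_combination (μ₁ * Real.sin θ + μ₂ * Real.sin φ) * hsin +
          (μ₁ * Real.cos θ + μ₂ * Real.cos φ) * hcos - μ₁ ^ 2 * h1 + μ₂ ^ 2 * h2
      exact (pow_left_inj₀ hμ₁.le hμ₂.le two_ne_zero).1 this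
    subst hμ12
    have hsin' := mul_left_cancel₀ hμ₁.ne' hsin
    have hcos' := mul_left_cancel₀ hμ₁.ne' hcos
    -- The tie directions differ from the ends `θ₀` and `θ₁`, so `0 < φ - θ < 2π` and the two facets
    -- cannot have the same direction.
    have hne1 : θ ≠ θ₁ := by rintro rfl; omega
    have hne0 : θ ≠ θ₀ := by
      rintro rfl
      have := hbelow θ fun _ => rfl
      omega
    have hlt1 : θ < θ₁ := lt_of_le_of_ne hθ.2 hne1
    have hlt0 : θ₀ < θ := lt_of_le_of_ne hθ.1 hne0.symm
    have hc : Real.cos (φ - θ) = 1 := by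
      rw [Real.cos_sub, ← hsin', ← hcos']
      linear_combination Real.sin_sq_add_cos_sq θ
    have := (Real.cos_eq_one_iff_of_lt_of_lt (x := φ - θ)
      (by linarith [hφ.1, Real.pi_pos]) (by linarith [hφ.2])).1 hc
    linarith [hφ.1]
  · push Not at hcase
    -- If `s` were alone in its class, all other colors, at least `t + 1` of them, would be above it
    -- in the direction opposite to `θ₀`.
    have hcard : 1 < #(T.filter fun p => κ p = κ s) := by
      by_contra hcon
      have huniq : ∀ p ∈ T, κ p = κ s → p = s := by
        intro p hp hps
        exact card_le_one.1 (not_lt.1 hcon) p (mem_filter.2 ⟨hp, hps⟩) s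
          (mem_filter.2 ⟨hsT, rfl⟩)
      have hlt := hcase (θ₀ + Real.pi)
      have hsub : (colors κ T).erase (κ s) ⊆ above x κ T (κ s) (θ₀ + Real.pi) := by
        intro b hb
        obtain ⟨q, hq, hqb⟩ := mem_image.1 (mem_of_mem_erase hb)
        refine mem_filter.2 ⟨hb, q, hq, hqb, fun p hp hpa => ?_⟩
        rw [huniq p hp hpa]
        have hqs : q ≠ s := by rintro rfl; exact ne_of_mem_erase hb hqb.symm
        have := hs' q hq hqs
        simp only [height, Real.cos_add_pi, Real.sin_add_pi] at this ⊢
        linarith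
      have := card_le_card hsub
      omega
    obtain ⟨σ, hσ, τ, hτ, hne, ⟨hσ1, hσ2, hσ3⟩, ⟨hτ1, hτ2, hτ3⟩⟩ :=
      exists_two_hull_edges hx hcard
    have hlevel : ∀ ρ ∈ T.offDiag, κ ρ.1 = κ s → κ ρ.2 = κ s → κ s ∉ met x κ T ρ.1 ρ.2 →
        (κ ρ.1 = κ s ∨ κ ρ.2 = κ s) ∧ LevelFacet x κ T t ρ.1 ρ.2 := by
      intro ρ hρ h1 h2 h3
      refine ⟨Or.inl h1, h1 ▸ h3, h2 ▸ h3, Or.inl ⟨h1.trans h2.symm, ?_⟩⟩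
      obtain ⟨θ, hθ⟩ := exists_met_subset_above hx (mem_offDiag.1 hρ).2.2 h3
      have := card_le_card hθ
      have := hcase θ
      omega
    exact ⟨σ, hσ, τ, hτ, hne, hlevel σ hσ hσ1 hσ2 hσ3, hlevel τ hτ hτ1 hτ2 hτ3⟩

/-! ### Lower bound: deleting a color class -/

/-- Removing a color class lowers the level of every remaining facet by at most one. -/
lemma weight_filter_le (x : α → Plane) (κ : α → ι) (T : Finset α) (K : ℕ) {a : ι} {p q : α}
    (hp : κ p ≠ a) (hq : κ q ≠ a) :
    weight x κ (T.filter fun r => κ r ≠ a) K p q ≤ weight x κ T (K + 1) p q := by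
  have hmet : met x κ (T.filter fun r => κ r ≠ a) p q = (met x κ T p q).erase a := by
    ext c
    simp only [mem_met, mem_erase, mem_filter]
    constructor
    · rintro ⟨r, ⟨hr, hra⟩, hpos, rfl⟩
      exact ⟨hra, r, hr, hpos, rfl⟩
    · rintro ⟨hca, r, hr, hpos, rfl⟩
      exact ⟨r, ⟨hr, hca⟩, hpos, rfl⟩
  unfold weight
  rw [hmet]
  have hcard := pred_card_le_card_erase (s := met x κ T p q) (a := a)
  simp only [mem_erase, hp, hq, ne_eq, not_false_eq_true, true_and]
  split_ifs <;> omega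

/-- Lower bound for the weighted facet count. -/
theorem facetSum_lower {x : α → Plane} (hx : GeneralPosition x) (κ : α → ι) (K : ℕ)
    (T : Finset α) (hK : K + 1 ≤ #(colors κ T)) :
    K * (K + 1) ≤ facetSum x κ T K := by
  induction K generalizing T with
  | zero => simp
  | succ K ih =>
    have hne : T.Nonempty := by
      rw [nonempty_iff_ne_empty]; rintro rfl; simp [colors] at hK
    obtain ⟨s, hsT, v₀, v₁, hs⟩ := exists_extreme hx.injective hne
    set a := κ s
    have hcol : colors κ (T.filter fun r => κ r ≠ a) = (colors κ T).erase a := by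
      ext c
      simp only [colors, mem_image, mem_filter, mem_erase]
      constructor
      · rintro ⟨r, ⟨hr, hra⟩, rfl⟩
        exact ⟨hra, r, hr, rfl⟩
      · rintro ⟨hca, r, hr, rfl⟩
        exact ⟨r, ⟨hr, hca⟩, rfl⟩
    have h1 := ih (T.filter fun r => κ r ≠ a) (by
      rw [hcol, card_erase_of_mem (show a ∈ colors κ T from mem_image_of_mem κ hsT)]; omega)
    have hsplit := sum_filter_add_sum_filter_not T.offDiag (fun σ => κ σ.1 = a ∨ κ σ.2 = a)
      (fun σ => weight x κ T (K + 1) σ.1 σ.2)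
    have h2 : facetSum x κ (T.filter fun r => κ r ≠ a) K ≤
        ∑ σ ∈ T.offDiag.filter (fun σ => ¬(κ σ.1 = a ∨ κ σ.2 = a)),
          weight x κ T (K + 1) σ.1 σ.2 := by
      have : (T.filter fun r => κ r ≠ a).offDiag =
          T.offDiag.filter (fun σ => ¬(κ σ.1 = a ∨ κ σ.2 = a)) := by
        ext σ; simp only [mem_offDiag, mem_filter]; tauto
      rw [facetSum, this]
      refine sum_le_sum fun σ hσ => ?_
      have := (mem_filter.1 hσ).2
      exact weight_filter_le x κ T K (fun h => this (Or.inl h)) (fun h => this (Or.inr h))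
    have h3 : 2 * (K + 1) ≤ ∑ σ ∈ T.offDiag.filter (fun σ => κ σ.1 = a ∨ κ σ.2 = a),
        weight x κ T (K + 1) σ.1 σ.2 := by
      simp only [weight_eq_sum]
      rw [sum_comm]
      -- Two facets for each of the levels `0, ..., K`.
      have : 2 * (K + 1) = ∑ _t ∈ range (K + 1), 2 := by simp [mul_comm]
      rw [this]
      refine sum_le_sum fun t ht => ?_
      rw [← card_filter]
      obtain ⟨σ, hσ, τ, hτ, hne, hσ', hτ'⟩ := exists_two_facets hx (κ := κ) hsT hs (t := t)
        (by have := mem_range.1 ht; omega)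
      exact one_lt_card.2 ⟨σ, mem_filter.2 ⟨mem_filter.2 ⟨hσ, hσ'.1⟩, hσ'.2⟩, τ,
        mem_filter.2 ⟨mem_filter.2 ⟨hτ, hτ'.1⟩, hτ'.2⟩, hne⟩
    have h4 : facetSum x κ T (K + 1) = _ := hsplit.symm
    rw [h4]
    nlinarith

end

/-! ### Transfer to the facet numbers of the statement -/

lemma generalPosition_coe {S : Finset Plane} (hS : NoThreeCollinear S) :
    GeneralPosition (fun p : S => (p : Plane)) where
  injective := Subtype.val_injective
  cross_ne_zero p q r hpq hpr hqr h := by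
    refine hS p p.2 q q.2 r r.2 (Subtype.coe_ne_coe.2 hpq) (Subtype.coe_ne_coe.2 hpr)
      (Subtype.coe_ne_coe.2 hqr) ?_
    rw [collinear_iff_of_mem (p₀ := (p : Plane)) (by simp)]
    have hne : (q : Plane) 0 - (p : Plane) 0 ≠ 0 ∨ (q : Plane) 1 - (p : Plane) 1 ≠ 0 := by
      by_contra! hcon
      apply hpq
      apply Subtype.ext
      ext i
      fin_cases i
      · exact (sub_eq_zero.1 hcon.1).symm
      · exact (sub_eq_zero.1 hcon.2).symm
    refine ⟨(q : Plane) - p, ?_⟩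
    intro z hz
    rcases hz with rfl | rfl | rfl
    · exact ⟨0, by simp⟩
    · exact ⟨1, by simp⟩
    · simp only [cross] at h
      rcases hne with h0 | h1
      · refine ⟨((r : Plane) 0 - (p : Plane) 0) / ((q : Plane) 0 - (p : Plane) 0), ?_⟩
        ext i
        fin_cases i
        · simp; field_simp; ring
        · simp; field_simp; linarith
      · refine ⟨((r : Plane) 1 - (p : Plane) 1) / ((q : Plane) 1 - (p : Plane) 1), ?_⟩
        ext i
        fin_cases i
        · simp; field_simp; linarith
        · simp; field_simp; ring

variable {S : Finset Plane} {m : ℕ}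

lemma colorsMet_eq_met (κ : S → Fin m) (p q : S) :
    colorsMet κ (posSide p q) = (met (fun p : S => (p : Plane)) κ univ p q : Set (Fin m)) := by
  ext i
  rw [mem_coe, mem_met]
  simp only [colorsMet, Set.mem_ofPred_eq, mem_univ, true_and, mem_posSide]
  exact exists_congr fun s => and_comm

/-- The condition on a segment to be a facet with `j` colors on its positive side. -/
def IsFacet (κ : S → Fin m) (j : ℕ) (σ : S × S) : Prop :=
  (κ σ.1 ∉ met (fun p : S => (p : Plane)) κ univ σ.1 σ.2 ∧
    κ σ.2 ∉ met (fun p : S => (p : Plane)) κ univ σ.1 σ.2) ∧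
    #(met (fun p : S => (p : Plane)) κ univ σ.1 σ.2) = j

lemma mem_coloredFacets (κ : S → Fin m) (c j : ℕ) (σ : S × S) :
    σ ∈ coloredFacets κ c j ↔ σ.1 ≠ σ.2 ∧ IsFacet κ j σ ∧
      ({κ σ.1, κ σ.2} : Set (Fin m)).ncard = c := by
  simp only [coloredFacets, Set.mem_ofPred_eq, colorsMet_eq_met, Set.ncard_coe_finset, IsFacet,
    Set.disjoint_insert_right, Set.disjoint_singleton_right, mem_coe, and_assoc]

lemma numFacets_two (κ : S → Fin m) (j : ℕ) :
    numFacets κ 2 j =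
      ∑ σ ∈ (univ : Finset S).offDiag, if IsFacet κ j σ ∧ κ σ.1 ≠ κ σ.2 then 1 else 0 := by
  rw [← card_filter, ← Set.ncard_coe_finset, numFacets]
  congr 1
  ext σ
  rw [mem_coloredFacets, mem_coe, mem_filter, mem_offDiag]
  by_cases h : κ σ.1 = κ σ.2
  · simp [h]
  · simp [h, Set.ncard_pair h]

lemma numFacets_one (κ : S → Fin m) (j : ℕ) :
    numFacets κ 1 j =
      ∑ σ ∈ (univ : Finset S).offDiag, if IsFacet κ j σ ∧ κ σ.1 = κ σ.2 then 1 else 0 := by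
  rw [← card_filter, ← Set.ncard_coe_finset, numFacets]
  congr 1
  ext σ
  rw [mem_coloredFacets, mem_coe, mem_filter, mem_offDiag]
  by_cases h : κ σ.1 = κ σ.2
  · simp [h]
  · simp [h, Set.ncard_pair h]

lemma weight_eq_sum_isFacet (κ : S → Fin m) (K : ℕ) (σ : S × S) :
    weight (fun p : S => (p : Plane)) κ univ K σ.1 σ.2 =
      ∑ j ∈ range K, (if IsFacet κ j σ ∧ κ σ.1 ≠ κ σ.2 then 1 else 0) +
      ∑ j ∈ range K, (K - j) * (if IsFacet κ j σ ∧ κ σ.1 = κ σ.2 then 1 else 0) := by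
  unfold weight IsFacet
  by_cases h : κ σ.1 ∉ met (fun p : S => (p : Plane)) κ univ σ.1 σ.2 ∧
    κ σ.2 ∉ met (fun p : S => (p : Plane)) κ univ σ.1 σ.2
  · by_cases h' : κ σ.1 = κ σ.2
    · rw [if_pos h, if_pos h']
      simp only [h, h', not_false_eq_true, and_self, ne_eq, not_true_eq_false, and_false,
        if_false, sum_const_zero, zero_add, true_and, and_true, mul_ite, mul_one, mul_zero,
        sum_ite_eq, mem_range]
      split_ifs <;> omega
    · rw [if_pos h, if_neg h']
      simp only [h, h', not_false_eq_true, and_self, ne_eq, and_false,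
        if_false, sum_const_zero, add_zero, true_and, and_true, mul_zero,
        sum_ite_eq, mem_range]
  · simp only [h, false_and, if_false, mul_zero, sum_const_zero, add_zero]

lemma facetSum_univ (κ : S → Fin m) (K : ℕ) :
    facetSum (fun p : S => (p : Plane)) κ univ K =
      ∑ j ∈ range K, numFacets κ 2 j + ∑ j ∈ range K, (K - j) * numFacets κ 1 j := by
  simp only [facetSum, weight_eq_sum_isFacet, sum_add_distrib, numFacets_two, numFacets_one,
    mul_sum]
  rw [sum_comm, sum_comm (s := (univ : Finset S).offDiag)]

end ColoredFacets

theorem mainTheorem10 (n m : ℕ) (S : Finset ColoredFacets.Plane) (hn : S.card = n)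
    (hS : ColoredFacets.NoThreeCollinear S)
    (κ : S → Fin m) (hκ : Function.Surjective κ)
    (k : ℕ) (hk : k + 2 ≤ m) :
    ((k : ℤ) + 1) * ((k : ℤ) + 2) ≤
        ∑ j ∈ Finset.range (k + 1), (ColoredFacets.numFacets κ 2 j : ℤ) +
          ∑ j ∈ Finset.range (k + 1), ((k : ℤ) - (j : ℤ) + 1) * (ColoredFacets.numFacets κ 1 j : ℤ) ∧
      ∑ j ∈ Finset.range (k + 1), (ColoredFacets.numFacets κ 2 j : ℤ) +
          ∑ j ∈ Finset.range (k + 1), ((k : ℤ) - (j : ℤ) + 1) * (ColoredFacets.numFacets κ 1 j : ℤ) ≤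
        ((k : ℤ) + 1) * (2 * (n : ℤ) - (k : ℤ) - 2) := by
  have hx := ColoredFacets.generalPosition_coe hS
  have hcol : (ColoredFacets.colors κ Finset.univ).card = m := by
    have huniv : ColoredFacets.colors κ Finset.univ = Finset.univ :=
      Finset.eq_univ_iff_forall.2 fun i =>
        ColoredFacets.mem_colors.2 ((hκ i).imp fun p hp => ⟨Finset.mem_univ p, hp⟩)
    rw [huniv, Finset.card_univ, Fintype.card_fin]
  have hsum : ((ColoredFacets.facetSum (fun p : S => (p : ColoredFacets.Plane)) κ Finset.univ
      (k + 1) : ℕ) : ℤ) = ∑ j ∈ Finset.range (k + 1), (ColoredFacets.numFacets κ 2 j : ℤ) +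
      ∑ j ∈ Finset.range (k + 1),
        ((k : ℤ) - (j : ℤ) + 1) * (ColoredFacets.numFacets κ 1 j : ℤ) := by
    rw [ColoredFacets.facetSum_univ]
    push_cast
    congr 1
    refine Finset.sum_congr rfl fun j hj => ?_
    have hj' : j ≤ k + 1 := (Finset.mem_range.1 hj).le
    rw [Nat.cast_sub hj']
    push_cast
    ring
  have hlow := ColoredFacets.facetSum_lower hx κ (k + 1) Finset.univ (by omega)
  have hup := ColoredFacets.facetSum_upper hx κ (k + 1) Finset.univ
  -- All colors occur and `m ≥ k + 2`, so the quadratic correction vanishes.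
  rw [hcol, show k + 1 - m = 0 by omega, Finset.card_univ, Fintype.card_coe, hn] at hup
  rw [← hsum]
  zify at hlow hup
  constructor
  · linarith
  · linarith
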